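/- Let $q$ be a prime power, let $m,s\ge 1$ and $n=sm$, and consider $\mathbb F_q\subseteq\mathbb F_{q^m}\subseteq\mathbb F_{q^n}$. Write $[i]=q^i$. Fix a basis $\varepsilon_1,\dots,\varepsilon_m$ of $\mathbb F_{q^m}$ over $\mathbb F_q$ and an element $\alpha\in\mathbb F_{q^n}$ such that $\alpha,\alpha^{[1]},\dots,\alpha^{[n-1]}$ is a (normal) basis of $\mathbb F_{q^n}$ over $\mathbb F_q$. **Conventions.** For a vector $\mathbf c$ over $\mathbb F_{q^m}$, let $M(\mathbf c)$ be the matrix over $\mathbb F_q$ whose columns are the coordinates of the entries of $\mathbf c$ in the basis $\varepsilon_1,\dots,\varepsilon_m$. For a code $\mathcal D$, $d_R(\mathcal D)$ is the minimum of $\operatorname{Rk}(M(\mathbf c)-M(\mathbf c'))$ over distinct $\mathbf c,\mathbf c'\in\mathcal D$ (with $d_R(\{0\})=\infty$). Duals $\mathcal D^\perp$ are taken for the bilinear form $\sum_i c_id_i$. For $\mathbf b\in\mathbb F_{q^m}^m$ and $\mathbf d=\sum_{i=1}^m\varepsilon_i\mathbf d_i\in\mathbb F_{q^m}^n$ with $\mathbf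 d_i\in\mathbb F_q^n$, put $\mathbf b\star_\varepsilon\mathbf d=\sum_{i=1}^m b_i\mathbf d_i$. For $\mathbf b\in\mathbb F_{q^n}^n$ and $\mathbf d=\sum_{k=0}^{n-1}\alpha^{[k]}\mathbf d_k\in\mathbb F_{q^n}^n$ with $\mathbf d_k\in\mathbb F_q^n$, put $\mathbf b\star_\alpha\mathbf d=\sum_{k=0}^{n-1}b_k\mathbf d_k$ (entries of $\mathbf b$ numbered from $0$). Write $\varepsilon_i=\sum_{k=0}^{n-1}e_{k,i}\alpha^{[k]}$ with $e_{k,i}\in\mathbb F_q$, and let $\varphi:\mathbb F_{q^m}^n\to\mathbb F_{q^m}^m$ be the $\mathbb F_{q^m}$-linear map $\varphi(\mathbf b)_i=\sum_{k=0}^{n-1}e_{k,i}b_k$. (If $s=1$ and $\varepsilon$ is the normal basis, $\varphi$ is the identity.) Let $\mathcal A,\mathcal C\subseteq\mathbb F_{q^m}^n$ be $\mathbb F_{q^m}$-linear codes, and let $\mathcal B$ be an $\mathbb F_{q^m}$-linear code contained in $\mathbb F_{q^m}^m$ (with $\star=\star_\varepsilon$) or in $\mathbb F_{q^m}^n$ (with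 $\star=\star_\alpha$). Let $\mathcal B\star\mathcal A$ be the $\mathbb F_{q^m}$-span of all $\mathbf b\star\mathbf a$, $\mathbf b\in\mathcal B$, $\mathbf a\in\mathcal A$. The pair $(\mathcal A,\mathcal B)$ is a *$t$-rank error-locating pair of type I* for $\mathcal C$ with respect to $\star$ if $$\mathcal B\star\mathcal A\subseteq\mathcal C^\perp,\qquad \dim_{\mathbb F_{q^m}}\mathcal A>t,\qquad d_R(\mathcal B^\perp)>t,$$ and a *$t$-rank error-correcting pair ($t$-RECP) of type I* if moreover $d_R(\mathcal A)+d_R(\mathcal C)>n$. **The codes.** Let $I,J\subseteq\mathbb Z/n\mathbb Z$ (equivalently, $I,J\subseteq\{1,\dots,n\}$ read modulo $n$) be such that each of the $\mathbb F_q$-spans of $\{\alpha^{[i]}:i\in I\}$ and of $\{\alpha^{[j]}:j\in J\}$ is the set of roots in $\mathbb F_{q^n}$ of a $q$-linearized polynomial with coefficients in $\mathbb F_{q^m}$. For $S\subseteq\mathbb Z/n\mathbb Z$ let $\mathcal M_\alpha(S)$ be the matrix over $\mathbb F_{q^n}$ with rows $(\alpha^{[i]},\alpha^{[i+1]},\dots,\alpha^{[i+n-1]})$,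 $i\in S$. Let $\mathcal A$ and $\mathcal B$ be the subfield subcodes over $\mathbb F_{q^m}$ (intersections with $\mathbb F_{q^m}^n$) of the codes in $\mathbb F_{q^n}^n$ with generator matrices $\mathcal M_\alpha(I)$ and $\mathcal M_\alpha(J)$, and let $\mathcal C=\{\mathbf c\in\mathbb F_{q^m}^n:\mathcal M_\alpha(I+J)\,\mathbf c^T=0\}$, where $I+J=\{i+j:i\in I,\ j\in J\}$. **Theorem.** The restriction of $\star_\alpha$ to $\mathbb F_{q^m}^n$ takes values in $\mathbb F_{q^m}^n$, and $\mathbf b\star_\alpha\mathbf d=\varphi(\mathbf b)\star_\varepsilon\mathbf d$ for all $\mathbf b,\mathbf d\in\mathbb F_{q^m}^n$. Let $t$ be a positive integer and $\delta>t$ an integer. Assume that $\#I>t$ and that $J$ contains $\delta-1$ consecutive elements $b,b+1,\dots,b+\delta-2$ (modulo $n$). Then $(\mathcal A,\mathcal B)$ is a $t$-rank error-locating pair of type I for $\mathcal C$ with respect to $\star_\alpha$, and $(\mathcal A,\varphi(\mathcal B))$ is a $t$-rank error-locating pair of type I for $\mathcal C$ with respect to $\star_\varepsilon$. If moreover $d_R(\mathcal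 A)+d_R(\mathcal C)>n$, then $(\mathcal A,\mathcal B)$ is a $t$-RECP of type I for $\mathcal C$ with respect to $\star_\alpha$, and $(\mathcal A,\varphi(\mathcal B))$ is a $t$-RECP of type I for $\mathcal C$ with respect to $\star_\varepsilon$. -/

import Mathlib

open scoped Pointwise Polynomial

noncomputable section

namespace RankCodes

section Products

variable {F K : Type*} [Field F] [Field K] [Algebra F K]
variable {ι ν κ : Type*} [Fintype ι] [Fintype ν] [Fintype κ]

/-- The matrix `M(c)` of a vector `c` over `K` in the basis `e` of `K` over `F`: the entry `(i, l)`
is the `i`-th coordinate of `c l`, that is, `c l = ∑ i, M(c) i l • e i`. -/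
def coordMatrix (e : Module.Basis ι F K) (c : κ → K) : Matrix ι κ F :=
  Matrix.of fun i l => e.repr (c l) i

/-- The minimum rank distance of a code: the least rank of `M(c) - M(c')` over distinct codewords,
with the value `⊤` for a code that has at most one codeword. -/
def minRankDist (e : Module.Basis ι F K) (C : Set (κ → K)) : ℕ∞ :=
  ⨅ c ∈ C, ⨅ c' ∈ C, ⨅ _ : c ≠ c', ((coordMatrix e c - coordMatrix e c').rank : ℕ∞)

/-- The product `c ⋆ d = ∑ i, c i • d_i`, where `d = ∑ i, e i • d_i` with `d_i` over `F`. -/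
def star (e : Module.Basis ι F K) (c : ι → K) (d : κ → K) : κ → K :=
  fun l => ∑ i, coordMatrix e d i l • c i

/-- The product `c ⋆_φ d = φ(c) ⋆ d`. -/
def starVia (e : Module.Basis ι F K) (φ : (ν → K) →ₗ[K] (ι → K)) (c : ν → K) (d : κ → K) : κ → K :=
  star e (φ c) d

/-- The `K`-linear span of all products `p b a` with `b ∈ B`, `a ∈ A`. -/
def productCode (p : (ν → K) → (κ → K) → (κ → K)) (B : Submodule K (ν → K))
    (A : Submodule K (κ → K)) : Submodule K (κ → K) :=
  Submodule.span K {x | ∃ b ∈ B, ∃ a ∈ A, x = p b a}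

/-- The dual of a linear code for the bilinear form `∑ i, c i * d i`. -/
def dualCode (C : Submodule K (κ → K)) : Submodule K (κ → K) where
  carrier := {d | ∀ c ∈ C, c ⬝ᵥ d = 0}
  add_mem' := by
    intro x y hx hy c hc
    rw [dotProduct_add, hx c hc, hy c hc, add_zero]
  zero_mem' := by
    intro c _
    exact dotProduct_zero c
  smul_mem' := by
    intro r x hx c hc
    rw [dotProduct_smul, hx c hc, smul_zero]

/-- `(A, B)` is a `t`-rank error-locating pair of type I for `C`, with respect to the product `p`
(one of the products `⋆` or `⋆_φ`). -/
structure IsRankErrorLocatingPair (e : Module.Basis ι F K)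
    (p : (ν → K) → (κ → K) → (κ → K)) (t : ℕ)
    (A : Submodule K (κ → K)) (B : Submodule K (ν → K)) (C : Submodule K (κ → K)) : Prop where
  product_le : productCode p B A ≤ dualCode C
  lt_dim : t < Module.finrank K A
  lt_dist : (t : ℕ∞) < minRankDist e (dualCode B : Set (ν → K))

/-- `(A, B)` is a `t`-rank error-correcting pair (`t`-RECP) of type I for `C`, with respect to the
product `p`. -/
structure IsRankErrorCorrectingPair (e : Module.Basis ι F K)
    (p : (ν → K) → (κ → K) → (κ → K)) (t : ℕ)
    (A : Submodule K (κ → K)) (B : Submodule K (ν → K)) (C : Submodule K (κ → K)) : Prop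
    extends IsRankErrorLocatingPair e p t A B C where
  dist_add : (Fintype.card κ : ℕ∞) <
    minRankDist e (A : Set (κ → K)) + minRankDist e (C : Set (κ → K))

end Products

section Extension

variable (K : Type*) {L : Type*} [Field K] [Field L] [Algebra K L]
variable {ι κ : Type*} [Fintype κ]

/-- The inclusion of `K ^ κ` in `L ^ κ`. -/
def embed : (κ → K) →ₗ[K] (κ → L) :=
  (Algebra.linearMap K L).compLeft κ

/-- The subfield subcode over `K` of a linear code over `L`. -/
def subfieldSubcode (D : Submodule L (κ → L)) : Submodule K (κ → K) :=
  (D.restrictScalars K).comap (embed K)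

/-- The subfield subcode over `K` of the code over `L` with generator matrix `G`. -/
def genCode (G : Matrix ι κ L) : Submodule K (κ → K) :=
  subfieldSubcode K (Submodule.span L (Set.range G))

/-- The code over `K` with parity check matrix `H` over `L`. -/
def checkCode (H : Matrix ι κ L) : Submodule K (κ → K) :=
  subfieldSubcode K (LinearMap.ker H.mulVecLin)

/-- `T` is the set of roots in `L` of a `q`-linearized polynomial with coefficients in `K`, where
`q` is the number of elements of `F`. -/
def IsQRootSpace {F : Type*} [Field F] [Algebra F L] (T : Submodule F L) : Prop :=
  ∃ P : K[X], (∀ i, P.coeff i ≠ 0 → ∃ k, i = Nat.card F ^ k) ∧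
    ∀ x : L, x ∈ T ↔ Polynomial.aeval x P = 0

end Extension

section NormalBasis

variable {L : Type*} [Field L]

/-- The matrix whose row with index `i` is `(β i, (β i) ^ q, …, (β i) ^ (q ^ (n - 1)))`. -/
def qMatrix (q n : ℕ) {ι : Type*} (β : ι → L) : Matrix ι (Fin n) L :=
  Matrix.of fun i l => β i ^ q ^ (l : ℕ)

/-- The conjugate `α ^ (q ^ i)`, with the exponent `i` read modulo `n`. -/
def conj (q n : ℕ) (α : L) (i : ZMod n) : L :=
  α ^ q ^ i.val

/-- The matrix `M_α(I)`, with rows indexed by `I`. -/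
def normalMatrix (q n : ℕ) (α : L) (I : Finset (ZMod n)) : Matrix I (Fin n) L :=
  qMatrix q n fun i : I => conj q n α i

end NormalBasis

section ChangeOfBasis

variable {F K L : Type*} [Field F] [Field K] [Field L] [Algebra F K] [Algebra K L] [Algebra F L]
variable {ι ν : Type*} [Fintype ν]

/-- For a basis `e` of `K` over `F` and a basis `a` of `L` over `F`, the `K`-linear map
`φ(b)_i = ∑ k, (k-th coordinate of e i in the basis a) • b k`. -/
def basisMap (e : Module.Basis ι F K) (a : Module.Basis ν F L) : (ν → K) →ₗ[K] (ι → K) :=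
  Matrix.mulVecLin (Matrix.of fun i k => algebraMap F K (a.repr (algebraMap K L (e i)) k))

end ChangeOfBasis

end RankCodes

end

/-! Over `L`, multiplying by row `j` of `M_α(J)` with `star a` applies the `q^j`-Frobenius
entrywise, and this sends row `i` of `M_α(I)` to row `i + j`. So the product of the two extended
codes lies in the code generated by `M_α(I + J)`, whose rows annihilate `C` (`star_mem_normalCode`).
The remaining conditions concern subfield subcodes. The root-space hypothesis makes the extended
codes Galois-stable, and Galois descent then shows that passing to `K` loses neither dimension
(whence `dim A > t`) nor parity checks (whence a word of the dual of `B` satisfies every check in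
`M_α(J)`). The `δ - 1` consecutive checks give rank at least `δ`, by nonsingularity of Moore
matrices (`le_rank_coordMatrix`). Finally, `basisMap` has entries in `F` and an injective transpose,
so results for `B` carry over to its image (`exists_mem_dualCode_of_map_basisMap`). -/

namespace RankCodes

/-! ### Linearized polynomials and Moore matrices -/

section Frobenius

variable {F L : Type*} [Field F] [Finite F] [Field L] [Algebra F L]

/-- Powers of the Frobenius of `F` are `F`-algebra endomorphisms. -/
theorem exists_algHom_pow (F : Type*) {L : Type*} [Field F] [Finite F] [Field L] [Algebra F L]
    (k : ℕ) : ∃ f : L →ₐ[F] L, ∀ x, f x = x ^ Nat.card F ^ k := by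
  have := Fintype.ofFinite F
  refine ⟨FiniteField.frobeniusAlgHom F L ^ k, fun x => ?_⟩
  rw [AlgHom.coe_pow, FiniteField.coe_frobeniusAlgHom, pow_iterate, Nat.card_eq_fintype_card]

theorem linearIndependent_pow {ι : Type*} {β : ι → L} (hβ : LinearIndependent F β) (k : ℕ) :
    LinearIndependent F fun i => β i ^ Nat.card F ^ k := by
  obtain ⟨f, hf⟩ := exists_algHom_pow F (L := L) k
  have heq : (fun i => β i ^ Nat.card F ^ k) = f.toLinearMap ∘ β := funext fun i => (hf (β i)).symm
  rw [heq]
  exact hβ.map' f.toLinearMap (LinearMap.ker_eq_bot.2 f.injective)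

/-- A linearized polynomial of `q`-degree less than `r` that vanishes on `r` linearly independent
elements is zero. -/
theorem eq_zero_of_sum_mul_pow_eq_zero {r : ℕ} {β : Fin r → L} (hβ : LinearIndependent F β)
    (w : Fin r → L) (h : ∀ k, ∑ i, w i * β k ^ Nat.card F ^ (i : ℕ) = 0) : w = 0 := by
  have := Fintype.ofFinite F
  have hq : 1 < Nat.card F := Finite.one_lt_card
  choose f hf using fun i : Fin r => exists_algHom_pow F (L := L) (i : ℕ)
  let T : L →ₗ[F] L := ∑ i, w i • (f i).toLinearMap
  have hT : ∀ x, T x = ∑ i, w i * x ^ Nat.card F ^ (i : ℕ) := by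
    intro x
    simp [T, hf]
  let P : L[X] := ∑ i, Polynomial.C (w i) * Polynomial.X ^ Nat.card F ^ (i : ℕ)
  have hP : P = 0 := by
    -- The `F`-combinations of the `β k` give `q ^ r` distinct roots, while the degree is less than
    -- `q ^ r`.
    refine Polynomial.eq_zero_of_natDegree_lt_card_of_eval_eq_zero P
      (f := fun c : Fin r → F => ∑ k, c k • β k)
      (linearIndependent_iff_injective_fintypeLinearCombination.1 hβ) (fun c => ?_) ?_
    · have : P.eval (∑ k, c k • β k) = T (∑ k, c k • β k) := by
        rw [hT, Polynomial.eval_finsetSum]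
        simp
      rw [this, map_sum]
      refine Finset.sum_eq_zero fun k _ => ?_
      rw [map_smul, hT, h, smul_zero]
    · rw [Fintype.card_fun, Fintype.card_fin, ← Nat.card_eq_fintype_card]
      refine (Polynomial.natDegree_sum_le _ _).trans_lt ?_
      rw [Finset.fold_max_lt]
      refine ⟨pow_pos (by omega) r, fun i _ => ?_⟩
      exact (Polynomial.natDegree_C_mul_X_pow_le _ _).trans_lt (Nat.pow_lt_pow_right hq i.2)
  funext j
  have := congrArg (fun p => p.coeff (Nat.card F ^ (j : ℕ))) hP
  simp only [P, Polynomial.finsetSum_coeff, Polynomial.coeff_C_mul, Polynomial.coeff_X_pow,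
    Polynomial.coeff_zero] at this
  rw [Finset.sum_eq_single j] at this
  · simpa using this
  · intro i _ hij
    rw [if_neg, mul_zero]
    intro h
    exact hij (Fin.ext (Nat.pow_right_injective hq h.symm))
  · simp

/-- The columns of a square Moore matrix of linearly independent elements are linearly
independent. -/
theorem eq_zero_of_sum_pow_mul_eq_zero {ι : Type*} [Fintype ι] {β : ι → L}
    (hβ : LinearIndependent F β) (u : ι → L)
    (h : ∀ i < Fintype.card ι, ∑ k, u k * β k ^ Nat.card F ^ i = 0) : u = 0 := by
  let e := (Fintype.equivFin ι).symm
  let M : Matrix (Fin (Fintype.card ι)) (Fin (Fintype.card ι)) L :=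
    Matrix.of fun k i => β (e k) ^ Nat.card F ^ (i : ℕ)
  have hdet : M.det ≠ 0 := by
    intro h0
    obtain ⟨w, hw, hMw⟩ := Matrix.exists_mulVec_eq_zero_iff.2 h0
    refine hw (eq_zero_of_sum_mul_pow_eq_zero (hβ.comp e e.injective) w fun k => ?_)
    simpa [M, Matrix.mulVec, dotProduct, mul_comm] using congrFun hMw k
  have hu : (u ∘ e) = 0 := by
    refine Matrix.eq_zero_of_vecMul_eq_zero hdet ?_
    funext i
    have := h i i.2
    rw [← e.sum_comp] at this
    simpa [M, Matrix.vecMul, dotProduct] using this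
  funext k
  simpa using congrFun hu (e.symm k)

end Frobenius

/-! ### Galois descent for subfield subcodes -/

section Descent

variable {K L : Type*} [Field K] [Field L] [Algebra K L] {κ : Type*}

/-- A code over `L` that is stable under the Galois group of `L` over `K` is spanned by its
subfield subcode over `K`. -/
theorem le_span_embed_subfieldSubcode [FiniteDimensional K L] [IsGalois K L]
    (D : Submodule L (κ → L)) (hD : ∀ σ : L ≃ₐ[K] L, ∀ v ∈ D, (fun l => σ (v l)) ∈ D) :
    D ≤ Submodule.span L (embed K '' (subfieldSubcode K D : Set (κ → K))) := by
  intro v hv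
  let b := Module.finBasis K L
  -- Coordinates in `b` are traces against the dual basis; each trace is a sum of Galois conjugates,
  -- so each coordinate vector stays in `D`.
  have key : v = ∑ r, b r • embed (L := L) K fun l => Algebra.trace K L (v l * b.traceDual r) := by
    funext l
    conv_lhs => rw [← b.sum_repr (v l)]
    simp only [Finset.sum_apply, Pi.smul_apply, smul_eq_mul, embed, LinearMap.compLeft_apply,
      Function.comp_apply, Algebra.linearMap_apply]
    refine Finset.sum_congr rfl fun r _ => ?_
    have := b.traceDual.traceDual_repr_apply (v l) r
    rw [Module.Basis.traceDual_traceDual, Algebra.traceForm_apply] at this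
    rw [this, Algebra.smul_def, mul_comm]
  rw [key]
  refine Submodule.sum_mem _ fun r _ => Submodule.smul_mem _ _ (Submodule.subset_span ⟨_, ?_, rfl⟩)
  change embed K _ ∈ D
  have : embed (L := L) K (fun l => Algebra.trace K L (v l * b.traceDual r)) =
      ∑ σ : L ≃ₐ[K] L, σ (b.traceDual r) • fun l => σ (v l) := by
    funext l
    simp [embed, trace_eq_sum_automorphisms, mul_comm]
  rw [this]
  exact Submodule.sum_mem _ fun σ _ => Submodule.smul_mem _ _ (hD σ v hv)

theorem finrank_le_finrank_subfieldSubcode [Finite κ] [FiniteDimensional K L] [IsGalois K L]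
    (D : Submodule L (κ → L)) (hD : ∀ σ : L ≃ₐ[K] L, ∀ v ∈ D, (fun l => σ (v l)) ∈ D) :
    Module.finrank L D ≤ Module.finrank K (subfieldSubcode K D) := by
  have := Fintype.ofFinite κ
  let b := Module.finBasis K (subfieldSubcode K D)
  have hle : D ≤ Submodule.span L (Set.range fun r => embed (L := L) K (b r : κ → K)) := by
    refine (le_span_embed_subfieldSubcode D hD).trans (Submodule.span_le.2 ?_)
    rintro _ ⟨c, hc, rfl⟩
    have := congrArg (fun x : subfieldSubcode K D => embed (L := L) K (x : κ → K))
      (b.sum_repr ⟨c, hc⟩)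
    simp only [Submodule.coe_sum, Submodule.coe_smul, map_sum, map_smul] at this
    rw [← this]
    refine Submodule.sum_mem _ fun r _ => ?_
    rw [← algebraMap_smul L]
    exact Submodule.smul_mem _ _ (Submodule.subset_span ⟨r, rfl⟩)
  refine (Submodule.finrank_mono hle).trans ?_
  refine (finrank_range_le_card _).trans ?_
  rw [Fintype.card_fin]

end Descent

/-! ### Rank weight and the BCH-type bound -/

section Rank

variable {F K : Type*} [Field F] [Field K] [Algebra F K]
variable {ι κ : Type*}

theorem coordMatrix_sub (e : Module.Basis ι F K) (c c' : κ → K) :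
    coordMatrix e c - coordMatrix e c' = coordMatrix e (c - c') := by
  ext i l
  simp [coordMatrix]

variable [Fintype κ]

/-- A linear code has minimum rank distance more than `t` if all its nonzero words have rank more
than `t`. -/
theorem lt_minRankDist (e : Module.Basis ι F K) (C : Submodule K (κ → K)) (t : ℕ)
    (h : ∀ c ∈ C, c ≠ 0 → t < (coordMatrix e c).rank) :
    (t : ℕ∞) < minRankDist e (C : Set (κ → K)) := by
  refine lt_of_lt_of_le (Nat.cast_lt.2 t.lt_succ_self) ?_
  refine le_iInf₂ fun c hc => le_iInf₂ fun c' hc' => le_iInf fun hcc => ?_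
  rw [coordMatrix_sub]
  exact Nat.cast_le.2 (h _ (C.sub_mem hc hc') (sub_ne_zero.2 hcc))

variable [Fintype ι]

theorem rank_coordMatrix (e : Module.Basis ι F K) (c : κ → K) :
    (coordMatrix e c).rank = Module.finrank F (Submodule.span F (Set.range c)) := by
  rw [Matrix.rank_eq_finrank_span_cols, ← LinearEquiv.finrank_map_eq e.equivFun,
    Submodule.map_span, ← Set.range_comp]
  rfl

/-- A nonzero vector annihilated by `δ - 1` consecutive rows of a Moore matrix has rank at
least `δ`. -/
theorem le_rank_coordMatrix [Finite F] {L : Type*} [Field L] [Algebra K L] [Algebra F L]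
    [IsScalarTower F K L] (e : Module.Basis ι F K) {a : κ → L} (ha : LinearIndependent F a)
    {c : κ → K} (hc : c ≠ 0) {δ : ℕ}
    (h : ∀ i < δ - 1, ∑ l, algebraMap K L (c l) * a l ^ Nat.card F ^ i = 0) :
    δ ≤ (coordMatrix e c).rank := by
  rw [rank_coordMatrix]
  by_contra! hlt
  let V := Submodule.span F (Set.range c)
  have : FiniteDimensional F V := FiniteDimensional.span_of_finite F (Set.finite_range c)
  change Module.finrank F V < δ at hlt
  let v := Module.finBasis F V
  let x : κ → V := fun l => ⟨c l, Submodule.subset_span ⟨l, rfl⟩⟩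
  -- Factor `c = v X` with `v` a basis of the span of its entries and `X` over `F`. As `X` commutes
  -- with Frobenius, the checks on `c` at `a` become checks on `v` at `β = X a`.
  let β : Fin (Module.finrank F V) → L := fun k => ∑ l, v.repr (x l) k • a l
  have hβ : LinearIndependent F β := by
    rw [Fintype.linearIndependent_iff]
    intro g hg
    -- A relation `g` among the `β k` is a functional on `V` that kills every entry of `c`, hence is
    -- zero.
    have h0 : ∀ l, v.constr F g (x l) = 0 := by
      refine Fintype.linearIndependent_iff.1 ha _ ?_
      rw [← hg]
      simp only [β, Finset.smul_sum, Module.Basis.constr_apply_fintype, Finset.sum_smul,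
        Module.Basis.equivFun_apply]
      rw [Finset.sum_comm]
      refine Finset.sum_congr rfl fun k _ => Finset.sum_congr rfl fun l _ => ?_
      rw [smul_smul, smul_eq_mul, mul_comm]
    have hzero : v.constr F g = 0 := by
      have hspan : Submodule.span F (Set.range x) = ⊤ := by
        have h1 : Set.range x = Subtype.val ⁻¹' Set.range c := by
          ext y
          constructor
          · rintro ⟨l, rfl⟩
            exact ⟨l, rfl⟩
          · rintro ⟨l, hl⟩
            exact ⟨l, Subtype.ext hl⟩
        rw [h1]
        exact Submodule.span_span_coe_preimage
      refine LinearMap.ext_on_range hspan fun l => ?_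
      rw [h0, LinearMap.zero_apply]
    intro k
    have := v.constr_basis F g k
    rw [← this, hzero, LinearMap.zero_apply]
  have hcx : ∀ l, c l = ∑ k, v.repr (x l) k • (v k : K) := by
    intro l
    have := congrArg V.subtype (v.sum_repr (x l))
    rw [map_sum] at this
    exact this.symm
  -- With `finrank V < δ`, the `δ - 1` checks cover a full square Moore system, which forces the
  -- basis `v` to vanish.
  have hu : (fun k => algebraMap K L (v k)) = 0 := by
    refine eq_zero_of_sum_pow_mul_eq_zero hβ _ fun i hi => ?_
    rw [Fintype.card_fin] at hi
    obtain ⟨f, hf⟩ := exists_algHom_pow F (L := L) i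
    rw [← h i (by omega)]
    simp only [hcx, ← hf, β, map_sum, map_smul, Finset.mul_sum, Finset.sum_mul]
    rw [Finset.sum_comm]
    refine Finset.sum_congr rfl fun l _ => Finset.sum_congr rfl fun k _ => ?_
    rw [mul_smul_comm, ← smul_mul_assoc, ← algebraMap_smul K (v.repr (x l) k) (algebraMap K L _),
      ← algebraMap_smul K (v.repr (x l) k) (v k : K), Algebra.smul_def, smul_eq_mul, map_mul]
  refine hc (funext fun l => ?_)
  rw [hcx, Pi.zero_apply]
  refine Finset.sum_eq_zero fun k _ => ?_
  have : (v k : K) = 0 := by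
    simpa using congrFun hu k
  rw [this, smul_zero]

end Rank

end RankCodes

namespace RankCodes

/-! ### Comparison of the two star products -/

section ChangeOfBasis

variable {F K L : Type*} [Field F] [Field K] [Field L] [Algebra F K] [Algebra K L] [Algebra F L]
  [IsScalarTower F K L] {ι ν κ : Type*} [Fintype ι] [Fintype ν]

/-- Expand `d` in `e`, then each `e i` in `a`, and interchange the two sums. -/
theorem embed_starVia_basisMap [Fintype κ] (e : Module.Basis ι F K) (a : Module.Basis ν F L)
    (b : ν → K) (d : κ → K) :
    embed (L := L) K (starVia e (basisMap e a) b d) = star a (embed K b) (embed K d) := by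
  funext l
  have hd : algebraMap K L (d l) = ∑ i, e.repr (d l) i • algebraMap K L (e i) := by
    conv_lhs => rw [← e.sum_repr (d l)]
    rw [map_sum]
    exact Finset.sum_congr rfl fun i _ => map_smul (IsScalarTower.toAlgHom F K L) _ _
  simp only [embed, LinearMap.compLeft_apply, Function.comp_apply, Algebra.linearMap_apply,
    starVia, star, coordMatrix, Matrix.of_apply, basisMap, Matrix.mulVecLin_apply, Matrix.mulVec,
    dotProduct]
  rw [hd]
  simp only [map_sum, map_smul, Finsupp.coe_finsetSum, Finset.sum_apply, Finsupp.coe_smul,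
    Pi.smul_apply, Finset.sum_smul, Finset.smul_sum]
  rw [Finset.sum_comm]
  refine Finset.sum_congr rfl fun k _ => Finset.sum_congr rfl fun i _ => ?_
  rw [← Algebra.smul_def, smul_smul, smul_eq_mul]
  exact map_smul (IsScalarTower.toAlgHom F K L) _ _

/-- The transpose of `basisMap e a`, which has coefficients in `F`, does not increase ranks and
is injective. -/
theorem exists_mem_dualCode_of_map_basisMap (e : Module.Basis ι F K)
    (a : Module.Basis ν F L) (B : Submodule K (ν → K)) {d : ι → K}
    (hd : d ∈ dualCode (B.map (basisMap e a))) (hd0 : d ≠ 0) :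
    ∃ c ∈ dualCode B, c ≠ 0 ∧ (coordMatrix e c).rank ≤ (coordMatrix e d).rank := by
  let E : Matrix ι ν F := Matrix.of fun i k => a.repr (algebraMap K L (e i)) k
  let c : ν → K := fun k => ∑ i, E i k • d i
  refine ⟨c, fun b hb => ?_, fun hc => hd0 ?_, ?_⟩
  · rw [← hd _ ⟨b, hb, rfl⟩]
    simp only [dotProduct, c, basisMap, Matrix.mulVecLin_apply, Matrix.mulVec, Finset.mul_sum,
      Finset.sum_mul, Matrix.of_apply, E]
    rw [Finset.sum_comm]
    refine Finset.sum_congr rfl fun i _ => Finset.sum_congr rfl fun k _ => ?_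
    rw [Algebra.smul_def]
    ring
  · have hli : LinearIndependent F fun i => algebraMap K L (e i) :=
      e.linearIndependent.map' (IsScalarTower.toAlgHom F K L).toLinearMap
        (LinearMap.ker_eq_bot.2 (algebraMap K L).injective)
    funext i
    -- For each `j`, the `j`-th coordinates of `d` form a relation over `F` among the independent
    -- elements `e i` of `L`.
    refine (e.forall_coord_eq_zero_iff).1 fun j => ?_
    refine Fintype.linearIndependent_iff.1 hli (fun i => e.repr (d i) j) ?_ i
    refine (a.forall_coord_eq_zero_iff).1 fun k => ?_
    have := congrArg (fun x : K => e.repr x j) (congrFun hc k)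
    simpa [c, E, mul_comm] using this
  · have : coordMatrix e c = coordMatrix e d * E := by
      ext j k
      simp [coordMatrix, c, Matrix.mul_apply, mul_comm]
    rw [this]
    exact Matrix.rank_mul_le_left _ _

end ChangeOfBasis

/-! ### Codes generated by conjugates of a normal element -/

section NormalBasis

variable {L : Type*} [Field L]

/-- Applying `f` entrywise is `f`-semilinear, so generators suffice. Used for Galois automorphisms
and for powers of Frobenius. -/
theorem map_mem_of_mem_span {ι κ : Type*} (f : L →+* L) {v : ι → κ → L} {N : Submodule L (κ → L)}
    (h : ∀ i, (fun l => f (v i l)) ∈ N) {x : κ → L} (hx : x ∈ Submodule.span L (Set.range v)) :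
    (fun l => f (x l)) ∈ N := by
  let T : (κ → L) →ₛₗ[f] (κ → L) :=
    { toFun := fun x l => f (x l)
      map_add' := fun x y => funext fun l => map_add f _ _
      map_smul' := fun c x => funext fun l => map_mul f _ _ }
  have : Submodule.span L (Set.range v) ≤ N.comap T :=
    Submodule.span_le.2 (Set.range_subset_iff.2 h)
  exact this hx

theorem pow_pow_mod {q n : ℕ} [Finite L] (hL : Nat.card L = q ^ n) (x : L) (k : ℕ) :
    x ^ q ^ (k % n) = x ^ q ^ k := by
  have := Fintype.ofFinite L
  conv_rhs => rw [← Nat.div_add_mod k n, pow_add, pow_mul, pow_mul, ← hL,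
    Nat.card_eq_fintype_card, FiniteField.pow_card_pow]

theorem conj_add_natCast {q n : ℕ} [NeZero n] [Finite L] (hL : Nat.card L = q ^ n) (α : L)
    (i : ZMod n) (k : ℕ) : conj q n α (i + k) = conj q n α i ^ q ^ k := by
  rw [conj, conj, ZMod.val_add, ZMod.val_natCast, Nat.add_mod_mod, pow_pow_mod hL, pow_add, pow_mul]

theorem conj_add {q n : ℕ} [NeZero n] [Finite L] (hL : Nat.card L = q ^ n) (α : L)
    (i j : ZMod n) : conj q n α (i + j) = conj q n α i ^ q ^ j.val := by
  rw [← conj_add_natCast hL, ZMod.natCast_zmod_val]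

variable {F : Type*} [Field F] [Algebra F L] {n : ℕ} {α : L} {a : Module.Basis (Fin n) F L}

theorem linearIndependent_conj [NeZero n] (ha : ∀ i : Fin n, a i = α ^ Nat.card F ^ (i : ℕ)) :
    LinearIndependent F (conj (Nat.card F) n α) := by
  have heq : conj (Nat.card F) n α = a ∘ fun i : ZMod n => ⟨i.val, ZMod.val_lt i⟩ :=
    funext fun i => (ha ⟨i.val, ZMod.val_lt i⟩).symm
  rw [heq]
  refine a.linearIndependent.comp _ fun i j h => ZMod.val_injective n ?_
  simpa using h

theorem conj_pow_eq (ha : ∀ i : Fin n, a i = α ^ Nat.card F ^ (i : ℕ)) (j : ZMod n) (k : Fin n) :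
    conj (Nat.card F) n α j ^ Nat.card F ^ (k : ℕ) = a k ^ Nat.card F ^ j.val := by
  rw [ha, conj, ← pow_mul, ← pow_mul, mul_comm]

/-- The code over `L` generated by `M_α(S)`. -/
abbrev normalCode (q n : ℕ) (α : L) (S : Finset (ZMod n)) : Submodule L (Fin n → L) :=
  Submodule.span L (Set.range (normalMatrix q n α S))

theorem conj_pow_mem_normalCode {q : ℕ} {S : Finset (ZMod n)} {j : ZMod n} (hj : j ∈ S) :
    (fun l : Fin n => conj q n α j ^ q ^ (l : ℕ)) ∈ normalCode q n α S :=
  Submodule.subset_span ⟨⟨j, hj⟩, rfl⟩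

variable [Finite F]

/-- Since `S.card ≤ n`, the first `S.card` columns already form a nonsingular Moore matrix. -/
theorem finrank_normalCode [NeZero n] (ha : ∀ i : Fin n, a i = α ^ Nat.card F ^ (i : ℕ))
    (S : Finset (ZMod n)) : Module.finrank L (normalCode (Nat.card F) n α S) = S.card := by
  have hli : LinearIndependent L (normalMatrix (Nat.card F) n α S) := by
    refine Fintype.linearIndependent_iff.2 fun u hu => ?_
    refine congrFun (eq_zero_of_sum_pow_mul_eq_zero
      ((linearIndependent_conj ha).comp (Subtype.val : S → ZMod n) Subtype.val_injective) u ?_)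
    intro i hi
    have hin : i < n := by
      refine hi.trans_le ?_
      rw [Fintype.card_coe]
      exact (Finset.card_le_univ S).trans_eq (ZMod.card n)
    have := congrFun hu ⟨i, hin⟩
    simpa [normalMatrix, qMatrix] using this
  rw [finrank_span_eq_card hli, Fintype.card_coe]

theorem pow_mem_normalCode {S : Finset (ZMod n)} {x : L}
    (hx : x ∈ Submodule.span F (conj (Nat.card F) n α '' (S : Set (ZMod n)))) :
    (fun l : Fin n => x ^ Nat.card F ^ (l : ℕ)) ∈ normalCode (Nat.card F) n α S := by
  choose f hf using fun l : Fin n => exists_algHom_pow F (L := L) (l : ℕ)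
  let T : L →ₗ[F] (Fin n → L) := LinearMap.pi fun l => (f l).toLinearMap
  have hT : ∀ x, T x = fun l : Fin n => x ^ Nat.card F ^ (l : ℕ) := fun x => funext fun l => hf l x
  rw [← hT]
  suffices Submodule.span F (conj (Nat.card F) n α '' (S : Set (ZMod n))) ≤
      ((normalCode (Nat.card F) n α S).restrictScalars F).comap T from this hx
  rw [Submodule.span_le]
  rintro _ ⟨j, hj, rfl⟩
  change T _ ∈ normalCode (Nat.card F) n α S
  rw [hT]
  exact conj_pow_mem_normalCode hj

/-- The codes generated by `M_α(S)` are Galois-stable when the conjugates indexed by `S` span the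
root space of a polynomial over `K`. -/
theorem map_mem_normalCode {K : Type*} [Field K] [Algebra K L] {S : Finset (ZMod n)}
    (hS : IsQRootSpace K (Submodule.span F (conj (Nat.card F) n α '' (S : Set (ZMod n)))))
    (σ : L ≃ₐ[K] L) (v : Fin n → L) (hv : v ∈ normalCode (Nat.card F) n α S) :
    (fun l => σ (v l)) ∈ normalCode (Nat.card F) n α S := by
  obtain ⟨P, -, hP⟩ := hS
  refine map_mem_of_mem_span (σ : L →+* L) (fun j => ?_) hv
  -- A `K`-automorphism permutes the roots of a polynomial over `K`.
  have : σ (conj (Nat.card F) n α j) ∈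
      Submodule.span F (conj (Nat.card F) n α '' (S : Set (ZMod n))) := by
    rw [hP, ← AlgEquiv.coe_toAlgHom, Polynomial.aeval_algHom_apply,
      (hP _).1 (Submodule.subset_span ⟨j, j.2, rfl⟩), map_zero]
  convert pow_mem_normalCode this using 2 with l
  exact map_pow σ _ _

/-- The product of the codes generated by `M_α(J)` and `M_α(I)` is contained in the code generated
by `M_α(I + J)`. -/
theorem star_mem_normalCode [NeZero n] [Finite L] (hL : Nat.card L = Nat.card F ^ n)
    (ha : ∀ i : Fin n, a i = α ^ Nat.card F ^ (i : ℕ)) {I J : Finset (ZMod n)} {v d : Fin n → L}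
    (hv : v ∈ normalCode (Nat.card F) n α J) (hd : d ∈ normalCode (Nat.card F) n α I) :
    star a v d ∈ normalCode (Nat.card F) n α (I + J) := by
  induction hv using Submodule.span_induction with
  | mem v hv =>
    obtain ⟨j, rfl⟩ := hv
    obtain ⟨f, hf⟩ := exists_algHom_pow F (L := L) (j : ZMod n).val
    -- Row `j` lists the images of the basis `a` under the `q^j`-Frobenius `f`, so the product
    -- evaluates the `F`-linear map `f`.
    have hstar : star a (normalMatrix (Nat.card F) n α J j) d = fun l => f (d l) := by
      funext l
      conv_rhs => rw [← a.sum_repr (d l)]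
      rw [map_sum]
      refine Finset.sum_congr rfl fun k _ => ?_
      rw [map_smul, hf, ← conj_pow_eq ha]
      rfl
    rw [hstar]
    refine map_mem_of_mem_span (f : L →+* L) (fun i => ?_) hd
    convert conj_pow_mem_normalCode (q := Nat.card F) (α := α) (Finset.add_mem_add i.2 j.2)
      using 2 with l
    rw [conj_add hL, pow_right_comm]
    exact hf _
  | zero =>
    have : star a 0 d = 0 := by
      funext l
      simp [star]
    rw [this]
    exact Submodule.zero_mem _
  | add x y _ _ hx hy =>
    have : star a (x + y) d = star a x d + star a y d := by
      funext l
      simp [star, Finset.sum_add_distrib]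
    rw [this]
    exact Submodule.add_mem _ hx hy
  | smul c x _ hx =>
    have : star a (c • x) d = c • star a x d := by
      funext l
      simp [star, Finset.mul_sum]
    rw [this]
    exact Submodule.smul_mem _ _ hx

end NormalBasis

/-! ### Orthogonality over the extension field -/

section Duality

variable {K L : Type*} [Field K] [Field L] [Algebra K L] {κ : Type*} [Fintype κ]

theorem embed_dotProduct (c d : κ → K) :
    embed (L := L) K c ⬝ᵥ embed K d = algebraMap K L (c ⬝ᵥ d) := by
  simp [embed, dotProduct]

theorem dotProduct_eq_zero_of_mem_span {X : Set (κ → L)} {c v : κ → L}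
    (h : ∀ x ∈ X, x ⬝ᵥ c = 0) (hv : v ∈ Submodule.span L X) : v ⬝ᵥ c = 0 := by
  induction hv using Submodule.span_induction with
  | mem x hx => exact h x hx
  | zero => exact zero_dotProduct c
  | add x y _ _ hx hy => rw [add_dotProduct, hx, hy, add_zero]
  | smul r x _ hx => rw [smul_dotProduct, hx, smul_zero]

end Duality

/-! ### Product inclusion and distance of the dual -/

section MainResult

variable {F K L : Type*} [Field F] [Finite F] [Field K] [Field L] [Algebra F K] [Algebra K L]
  [Algebra F L] [IsScalarTower F K L] {ι : Type*} [Fintype ι] {n : ℕ} [NeZero n] [Finite L]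
  {α : L} {a : Module.Basis (Fin n) F L}

theorem productCode_le_dualCode_checkCode (hL : Nat.card L = Nat.card F ^ n)
    (ha : ∀ i : Fin n, a i = α ^ Nat.card F ^ (i : ℕ)) (e : Module.Basis ι F K)
    (I J : Finset (ZMod n)) :
    productCode (starVia e (basisMap e a)) (genCode K (normalMatrix (Nat.card F) n α J))
      (genCode K (normalMatrix (Nat.card F) n α I)) ≤
      dualCode (checkCode K (normalMatrix (Nat.card F) n α (I + J))) := by
  refine Submodule.span_le.2 ?_
  rintro _ ⟨b, hb, d, hd, rfl⟩ c hc
  apply (algebraMap K L).injective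
  rw [← embed_dotProduct, embed_starVia_basisMap, map_zero, dotProduct_comm]
  refine dotProduct_eq_zero_of_mem_span ?_ (star_mem_normalCode hL ha hb hd)
  rintro _ ⟨i, rfl⟩
  exact congrFun (show (normalMatrix (Nat.card F) n α (I + J)).mulVec (embed K c) = 0 from hc) i

/-- The lower bound of BCH type for the dual of a subfield subcode. -/
theorem le_rank_of_mem_dualCode_genCode [FiniteDimensional K L] [IsGalois K L]
    (hL : Nat.card L = Nat.card F ^ n)
    (ha : ∀ i : Fin n, a i = α ^ Nat.card F ^ (i : ℕ)) (e : Module.Basis ι F K)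
    {J : Finset (ZMod n)}
    (hJ : IsQRootSpace K (Submodule.span F (conj (Nat.card F) n α '' (J : Set (ZMod n)))))
    {δ : ℕ} {b : ZMod n} (hb : ∀ i : ℕ, i < δ - 1 → b + (i : ZMod n) ∈ J) {c : Fin n → K}
    (hc : c ∈ dualCode (genCode K (normalMatrix (Nat.card F) n α J))) (hc0 : c ≠ 0) :
    δ ≤ (coordMatrix e c).rank := by
  -- Raising the basis to the power `q ^ b` shifts the consecutive checks `b, b + 1, …` to start at
  -- exponent `0`.
  refine le_rank_coordMatrix e (linearIndependent_pow a.linearIndependent b.val) hc0 fun i hi => ?_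
  have hmem := le_span_embed_subfieldSubcode (K := K) _ (map_mem_normalCode hJ)
    (conj_pow_mem_normalCode (q := Nat.card F) (α := α) (hb i hi))
  have hzero := dotProduct_eq_zero_of_mem_span (c := embed (L := L) K c) ?_ hmem
  · rw [dotProduct_comm] at hzero
    rw [← hzero]
    refine Finset.sum_congr rfl fun l _ => ?_
    rw [conj_add_natCast hL, ← conj_pow_eq ha, pow_right_comm]
    rfl
  · rintro _ ⟨x, hx, rfl⟩
    rw [embed_dotProduct, hc x hx, map_zero]

end MainResult

end RankCodes

theorem mainTheorem10
    {F K L : Type*} [Field F] [Finite F] [Field K] [Field L]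
    [Algebra F K] [Algebra K L] [Algebra F L] [IsScalarTower F K L]
    (m s n : ℕ) (hn : n = s * m)
    (ε : Module.Basis (Fin m) F K)
    (α : L) (a : Module.Basis (Fin n) F L)
    (ha : ∀ i : Fin n, a i = α ^ Nat.card F ^ (i : ℕ))
    (I J : Finset (ZMod n))
    (hI : RankCodes.IsQRootSpace K
      (Submodule.span F (RankCodes.conj (Nat.card F) n α '' (I : Set (ZMod n)))))
    (hJ : RankCodes.IsQRootSpace K
      (Submodule.span F (RankCodes.conj (Nat.card F) n α '' (J : Set (ZMod n)))))
    (A B C : Submodule K (Fin n → K))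
    (hA : A = RankCodes.genCode K (RankCodes.normalMatrix (Nat.card F) n α I))
    (hB : B = RankCodes.genCode K (RankCodes.normalMatrix (Nat.card F) n α J))
    (hC : C = RankCodes.checkCode K (RankCodes.normalMatrix (Nat.card F) n α (I + J)))
    (φ : (Fin n → K) →ₗ[K] (Fin m → K)) (hφ : φ = RankCodes.basisMap ε a)
    (t δ : ℕ) (ht : 0 < t) (htI : t < I.card) (htδ : t < δ)
    (hcons : ∃ b : ZMod n, ∀ i : ℕ, i < δ - 1 → b + (i : ZMod n) ∈ J) :
    (∀ b d : Fin n → K,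
      RankCodes.embed (L := L) K (RankCodes.starVia ε φ b d) =
        RankCodes.star a (RankCodes.embed K b) (RankCodes.embed K d)) ∧
    RankCodes.IsRankErrorLocatingPair ε (RankCodes.starVia ε φ) t A B C ∧
    RankCodes.IsRankErrorLocatingPair ε (RankCodes.star ε) t A (B.map φ) C ∧
    ((n : ℕ∞) < RankCodes.minRankDist ε (A : Set (Fin n → K)) +
        RankCodes.minRankDist ε (C : Set (Fin n → K)) →
      RankCodes.IsRankErrorCorrectingPair ε (RankCodes.starVia ε φ) t A B C ∧
      RankCodes.IsRankErrorCorrectingPair ε (RankCodes.star ε) t A (B.map φ) C) := by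
  subst hA hB hC hφ
  have : Module.Finite F L := Module.Finite.of_basis a
  have : Finite L := Module.finite_of_finite F
  have hfr : Module.finrank F L = n := by
    rw [Module.finrank_eq_card_basis a, Fintype.card_fin]
  have hL : Nat.card L = Nat.card F ^ n := by
    rw [Module.natCard_eq_pow_finrank (K := F), hfr]
  have : NeZero n := ⟨hfr ▸ Module.finrank_pos.ne'⟩
  have : FiniteDimensional K L := Module.Finite.of_restrictScalars_finite F K L
  have : Finite K := Finite.of_injective _ (algebraMap K L).injective
  obtain ⟨b, hb⟩ := hcons
  have hdim : t < Module.finrank K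
      (RankCodes.genCode K (RankCodes.normalMatrix (Nat.card F) n α I)) := by
    refine htI.trans_le ?_
    rw [← RankCodes.finrank_normalCode ha I]
    exact RankCodes.finrank_le_finrank_subfieldSubcode _ (RankCodes.map_mem_normalCode hI)
  have hprod := RankCodes.productCode_le_dualCode_checkCode hL ha ε I J
  have h₁ : RankCodes.IsRankErrorLocatingPair ε (RankCodes.starVia ε (RankCodes.basisMap ε a)) t
      (RankCodes.genCode K (RankCodes.normalMatrix (Nat.card F) n α I))
      (RankCodes.genCode K (RankCodes.normalMatrix (Nat.card F) n α J))
      (RankCodes.checkCode K (RankCodes.normalMatrix (Nat.card F) n α (I + J))) := by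
    refine ⟨hprod, hdim, RankCodes.lt_minRankDist ε _ t fun c hc hc0 => ?_⟩
    exact htδ.trans_le (RankCodes.le_rank_of_mem_dualCode_genCode hL ha ε hJ hb hc hc0)
  have h₂ : RankCodes.IsRankErrorLocatingPair ε (RankCodes.star ε) t
      (RankCodes.genCode K (RankCodes.normalMatrix (Nat.card F) n α I))
      ((RankCodes.genCode K (RankCodes.normalMatrix (Nat.card F) n α J)).map
        (RankCodes.basisMap ε a))
      (RankCodes.checkCode K (RankCodes.normalMatrix (Nat.card F) n α (I + J))) := by
    refine ⟨le_trans (Submodule.span_mono ?_) hprod, hdim,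
      RankCodes.lt_minRankDist ε _ t fun d hd hd0 => ?_⟩
    · rintro _ ⟨_, ⟨x, hx, rfl⟩, y, hy, rfl⟩
      exact ⟨x, hx, y, hy, rfl⟩
    · obtain ⟨c, hc, hc0, hle⟩ := RankCodes.exists_mem_dualCode_of_map_basisMap ε a _ hd hd0
      exact htδ.trans_le
        ((RankCodes.le_rank_of_mem_dualCode_genCode hL ha ε hJ hb hc hc0).trans hle)
  refine ⟨RankCodes.embed_starVia_basisMap ε a, h₁, h₂, fun hdist => ?_⟩
  have hcard : ((Fintype.card (Fin n) : ℕ) : ℕ∞) = n := by rw [Fintype.card_fin]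
  exact ⟨⟨h₁, hcard.trans_lt hdist⟩, ⟨h₂, hcard.trans_lt hdist⟩⟩
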